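/- Let $Z$ be an infinite-dimensional separable (real or complex) Banach space, viewed as a Polish group under addition. Let $\mathrm{Lip}(Z)$ be the space of all 1-Lipschitz maps $f\colon Z\to\mathbb{R}$ with the topology of pointwise convergence, on which $Z$ acts by $(\zeta\cdot f)(z)=f(\zeta+z)$. Then there is a dense $G_\delta$ subset $X$ of $\mathrm{Lip}(Z)$, invariant under this action, such that, with the subspace topology and the restricted action: 1. $X$ is a Polish $Z$-space, i.e. $X$ is a Polish space and the action $Z\times X\to X$ is continuous; 2. the action is free: $\zeta\cdot x\neq x$ for all $x\in X$ and all $\zeta\in Z\setminus\{0\}$; 3. the action is stormy: for every non-empty open $V\subseteq Z$ and every $x\in X$, the map $\zeta\mapsto \zeta\cdot x$ from $V$ onto $V\cdot x=\{\zeta\cdot x : \zeta\in V\}$ (with the subspace topology) is not open; 4. the orbit equivalence relation $E^Z_X$, given by $x\mathrel{E^Z_X}x'$ if and only if $x$ and $x'$ have the same $Z$-orbit, is a Borel subset of $X\times X$; 5. $E^Z_X$ is not essentially countable: there are no standard Borel space $Y$, equivalence relation $F$ on $Y$ that is Borel in $Y\times Y$ and has only countable classes, and Borel map $f\colon X\to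 Y$ such that $x\mathrel{E^Z_X}x'\iff f(x)\mathrel{F}f(x')$ for all $x,x'\in X$. In particular, every infinite-dimensional separable Banach space $Z$ has a Polish $Z$-space whose orbit equivalence relation is Borel and not essentially countable. -/

import Mathlib

universe u v w

/-- The space of all 1-Lipschitz maps from `Z` to the real line. -/
def LipOne (Z : Type u) [NormedAddCommGroup Z] : Type u :=
  {f : Z → ℝ // LipschitzWith 1 f}

namespace LipOne

variable {Z : Type u} [NormedAddCommGroup Z]

/-- `LipOne Z` carries the topology of pointwise convergence: the subspace topology
inherited from the product topology on `Z → ℝ`. -/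
instance : TopologicalSpace (LipOne Z) :=
  inferInstanceAs (TopologicalSpace {f : Z → ℝ // LipschitzWith 1 f})

/-- `LipOne Z` carries the Borel σ-algebra of its topology. -/
instance : MeasurableSpace (LipOne Z) := borel (LipOne Z)

instance : BorelSpace (LipOne Z) := ⟨rfl⟩

/-- The translate `z ↦ f (ζ + z)` of a 1-Lipschitz map. -/
def translate (ζ : Z) (f : LipOne Z) : LipOne Z :=
  ⟨fun z => f.1 (ζ + z), f.2.comp (isometry_add_left ζ).lipschitz |>.weaken (by simp)⟩

/-- The shift action of the additive group `Z`, given by `(ζ · f)(z) = f (ζ + z)`. -/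
instance : AddAction Z (LipOne Z) where
  vadd := translate
  zero_vadd f := Subtype.ext (funext fun z => congrArg f.1 (zero_add z))
  add_vadd ζ ξ f := Subtype.ext (funext fun z => congrArg f.1 (by
    show ζ + ξ + z = ξ + (ζ + z)
    abel))

end LipOne

/-- A continuous action of an additive topological group `G` on a Polish space `X`. When `G` is
Polish, this says that `X` is a Polish `G`-space. -/
structure IsPolishGSpace (G : Type u) (X : Type v) [AddGroup G] [TopologicalSpace G]
    [TopologicalSpace X] [AddAction G X] : Prop where
  polish : PolishSpace X
  continuous_action : Continuous fun p : G × X => p.1 +ᵥ p.2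

/-- An action is free if no nonzero group element fixes a point. -/
def IsFreeAction (G : Type u) (X : Type v) [AddGroup G] [AddAction G X] : Prop :=
  ∀ g : G, g ≠ 0 → ∀ x : X, g +ᵥ x ≠ x

/-- An action is stormy if for every non-empty open `V ⊆ G` and every point `x`, the map
`g ↦ g +ᵥ x` from `V` onto `V +ᵥ x` is not open (both sets with their subspace topologies). -/
def IsStormy (G : Type u) (X : Type v) [AddGroup G] [TopologicalSpace G]
    [TopologicalSpace X] [AddAction G X] : Prop :=
  ∀ V : Set G, IsOpen V → V.Nonempty → ∀ x : X,
    ¬ IsOpenMap (V.imageFactorization fun g : G => g +ᵥ x)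

/-- An equivalence relation on a standard Borel space is Borel if it is a Borel subset of the
square of the space. -/
def IsBorelEquivalence {X : Type u} [MeasurableSpace X] (E : Setoid X) : Prop :=
  MeasurableSet {p : X × X | E p.1 p.2}

/-- `E` is Borel reducible to `F`: some Borel map `f` satisfies `x E y ↔ f x F f y`. -/
def BorelReducible {X : Type u} {Y : Type v} [MeasurableSpace X] [MeasurableSpace Y]
    (E : Setoid X) (F : Setoid Y) : Prop :=
  ∃ f : X → Y, Measurable f ∧ ∀ x x' : X, E x x' ↔ F (f x) (f x')

/-- A countable Borel equivalence relation: a Borel one with all classes countable. -/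
structure IsCountableBorelEquivalence {X : Type u} [MeasurableSpace X] (E : Setoid X) :
    Prop where
  borel : IsBorelEquivalence E
  countable_classes : ∀ x : X, {y : X | E x y}.Countable

/-- `E` is essentially countable if it is Borel reducible to a countable Borel equivalence
relation on a standard Borel space. The universe `v` of that space is arbitrary. -/
def IsEssentiallyCountable {X : Type u} [MeasurableSpace X] (E : Setoid X) : Prop :=
  ∃ (Y : Type v) (_ : MeasurableSpace Y) (_ : StandardBorelSpace Y) (F : Setoid Y),
    IsCountableBorelEquivalence F ∧ BorelReducible E F

/-! The set `X` consists of the maps that are varying and recurrent. Varying maps have no period: a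
nonzero period would be close to a dense vector along which the map changes too much. Recurrent maps
have approximate periods of every small size on every finite set, so a translate can return near its
start although the translating vector is not near 0; with freeness, this is storminess. Infinite
dimension makes recurrence dense: a finite set can be shifted along a common kernel of norming
functionals without bringing its points closer to their shifted copies, and McShane extension does
the rest.

A free stormy action is never essentially countable. Given a reduction `f`, countably many open sets
encode its fibres on a comeager set. Countability of classes and Baire category make this code
generically constant on pieces of orbits of uniform size. Fixing one value of the code cuts out a
locally invariant `Gδ` set `P` inside a single orbit. As `P` is Polish, an Effros-style category
argument gives a point where the orbit map is locally open, against storminess. Borelness of the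
relation is Lusin–Souslin applied to a free action. -/

open Set Filter Topology

/-! ### Baire category in Polish spaces and products -/

/-- A `Gδ` subset of a Polish space is Polish. -/
theorem IsGδ.polishSpace {X : Type*} [TopologicalSpace X] [PolishSpace X] {s : Set X}
    (hs : IsGδ s) : PolishSpace s := by
  obtain ⟨U, hU, rfl⟩ := isGδ_iff_eq_iInter_nat.1 hs
  have (n : ℕ) : PolishSpace (U n) := (hU n).polishSpace
  let e : (⋂ n, U n : Set X) → ∀ n, U n := fun x n => ⟨x.1, mem_iInter.1 x.2 n⟩
  have he : Continuous e := by fun_prop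
  have hp : Continuous fun y : ∀ n, U n => (y 0).1 := by fun_prop
  refine IsClosedEmbedding.polishSpace (f := e) ⟨⟨.of_comp he hp .subtypeVal, ?_⟩, ?_⟩
  · exact fun x y hxy => Subtype.ext (congrArg (fun z : ∀ n, U n => (z 0).1) hxy)
  · have : range e = {y | ∀ n, (y n).1 = (y 0).1} := by
      ext y
      refine ⟨?_, fun hy => ?_⟩
      · rintro ⟨x, rfl⟩ n
        rfl
      · exact ⟨⟨(y 0).1, mem_iInter.2 fun n => hy n ▸ (y n).2⟩,
          funext fun n => Subtype.ext (hy n).symm⟩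
    rw [this, ofPred_forall]
    exact isClosed_iInter fun n => isClosed_eq (by fun_prop) (by fun_prop)

/-- A property that holds on a dense part of an open set `Ω` in an open fashion
holds generically on `Ω`. -/
theorem eventually_residual_of_open_subset {X : Type*} [TopologicalSpace X] {Ω D : Set X}
    (hΩ : IsOpen Ω) (hD : IsOpen D) (h : Ω ⊆ closure (Ω ∩ D)) :
    ∀ᶠ x in residual X, x ∈ Ω → x ∈ D := by
  -- Adding the exterior of `Ω` makes the set dense in the whole space without affecting points of
  -- `Ω`.
  have ho : IsOpen (Ω ∩ D ∪ (closure Ω)ᶜ) := (hΩ.inter hD).union isClosed_closure.isOpen_compl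
  have hd : Dense (Ω ∩ D ∪ (closure Ω)ᶜ) := by
    intro x
    rw [closure_union]
    by_cases hx : x ∈ closure Ω
    · exact Or.inl (closure_minimal h isClosed_closure hx)
    · exact Or.inr (subset_closure hx)
  filter_upwards [residual_of_dense_open ho hd] with x hx hxΩ
  exact hx.elim And.right fun h => absurd (subset_closure hxΩ) h

/-- The Kuratowski–Ulam theorem: generic sections of a comeager set are comeager. -/
theorem eventually_residual_prod {A B : Type*} [TopologicalSpace A] [TopologicalSpace B]
    [SecondCountableTopology B] {p : A × B → Prop} (hp : ∀ᶠ z in residual (A × B), p z) :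
    ∀ᶠ a in residual A, ∀ᶠ b in residual B, p (a, b) := by
  obtain ⟨S, hSo, hSd, hSc, hS⟩ := mem_residual_iff.1 hp
  have key : ∀ t ∈ S, ∀ᶠ a in residual A, ∀ᶠ b in residual B, (a, b) ∈ t := by
    intro t ht
    have h1 : ∀ v ∈ TopologicalSpace.countableBasis B,
        ∀ᶠ a in residual A, ∃ b ∈ v, (a, b) ∈ t := by
      intro v hv
      have hvo := TopologicalSpace.isOpen_of_mem_countableBasis hv
      have heq : {a | ∃ b ∈ v, (a, b) ∈ t} = Prod.fst '' (t ∩ univ ×ˢ v) := by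
        ext a
        simp [and_comm]
      refine residual_of_dense_open (s := {a | ∃ b ∈ v, (a, b) ∈ t}) ?_ ?_
      · rw [heq]
        exact isOpenMap_fst _ ((hSo t ht).inter (isOpen_univ.prod hvo))
      · refine dense_iff_inter_open.2 fun W hW ⟨a, ha⟩ => ?_
        obtain ⟨b, hb⟩ := TopologicalSpace.nonempty_of_mem_countableBasis hv
        obtain ⟨⟨a', b'⟩, h, h'⟩ := (hSd t ht).inter_open_nonempty _ (hW.prod hvo) ⟨(a, b), ha, hb⟩
        exact ⟨a', h.1, b', h.2, h'⟩
    filter_upwards [(eventually_countable_ball (TopologicalSpace.countable_countableBasis B)).2 h1]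
      with a ha
    refine residual_of_dense_open (s := {b | (a, b) ∈ t}) ((hSo t ht).preimage (by fun_prop)) ?_
    refine (TopologicalSpace.isBasis_countableBasis B).dense_iff.2 fun v hv _ => ?_
    obtain ⟨b, hb, hb'⟩ := ha v hv
    exact ⟨b, hb, hb'⟩
  filter_upwards [(eventually_countable_ball hSc).2 key] with a ha
  filter_upwards [(eventually_countable_ball hSc).2 ha] with b hb
  exact hS (mem_sInter.2 hb)

/-- A generic property of a nonempty Baire space holds somewhere on each nonempty open set. -/
theorem Filter.Eventually.exists_mem_of_isOpen {X : Type*} [TopologicalSpace X] [BaireSpace X]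
    {p : X → Prop} (hp : ∀ᶠ x in residual X, p x) {U : Set X} (hU : IsOpen U)
    (hne : U.Nonempty) : ∃ x ∈ U, p x :=
  (dense_of_mem_residual hp).inter_open_nonempty U hU hne

/-! ### Vaught transforms and generic translates -/

section Action

variable {G X : Type*} [AddCommGroup G] [TopologicalSpace G] [TopologicalSpace X] [AddAction G X]

theorem eventually_residual_add [IsTopologicalAddGroup G] {p : G → Prop}
    (hp : ∀ᶠ g in residual G, p g) (a : G) : ∀ᶠ g in residual G, p (g + a) :=
  tendsto_residual_of_isOpenMap (continuous_add_const a) (isOpenMap_add_right a) hp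

/-- The Vaught transform of a `Gδ` set is `Gδ`. -/
theorem IsGδ.vaught [ContinuousVAdd G X] [SecondCountableTopology G] [BaireSpace G] {B : Set X}
    (hB : IsGδ B) {N : Set G} (hN : IsOpen N) :
    IsGδ {x : X | ∀ᶠ h in residual G, h ∈ N → h +ᵥ x ∈ B} := by
  obtain ⟨U, hU, rfl⟩ := isGδ_iff_eq_iInter_nat.1 hB
  have heq : {x : X | ∀ᶠ h in residual G, h ∈ N → h +ᵥ x ∈ ⋂ n, U n} =
      ⋂ n, ⋂ v ∈ {v ∈ TopologicalSpace.countableBasis G | (v ∩ N).Nonempty},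
        {x | ∃ h ∈ v ∩ N, h +ᵥ x ∈ U n} := by
    ext x
    simp only [mem_iInter, mem_ofPred_eq, and_imp]
    constructor
    · intro hx n v hv hne
      obtain ⟨h, hh, h'⟩ := hx.exists_mem_of_isOpen
        ((TopologicalSpace.isOpen_of_mem_countableBasis hv).inter hN) hne
      exact ⟨h, hh, h' hh.2 n⟩
    · intro hx
      have : ∀ n, ∀ᶠ h in residual G, h ∈ N → h ∈ {h | h +ᵥ x ∈ U n} := by
        intro n
        refine eventually_residual_of_open_subset hN ((hU n).preimage (by fun_prop)) ?_
        intro g hg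
        refine (TopologicalSpace.isBasis_countableBasis G).mem_closure_iff.2 fun v hv hgv => ?_
        obtain ⟨h, hh, h'⟩ := hx n v hv ⟨g, hgv, hg⟩
        exact ⟨h, hh.1, hh.2, h'⟩
      filter_upwards [eventually_countable_forall.2 this] with h hh hN n using hh n hN
  rw [heq]
  refine .iInter fun n => .biInter
    ((TopologicalSpace.countable_countableBasis G).mono fun v hv => hv.1) fun v _ => IsOpen.isGδ ?_
  have : {x : X | ∃ h ∈ v ∩ N, h +ᵥ x ∈ U n} = ⋃ h ∈ v ∩ N, {x | h +ᵥ x ∈ U n} := by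
    ext
    simp
  rw [this]
  exact isOpen_biUnion fun h _ => (hU n).preimage (by fun_prop)

/-- Generic translates of generic points of a locally invariant set are generic. -/
theorem eventually_residual_vadd_of_locally_invariant [ContinuousVAdd G X]
    [SecondCountableTopology G] {P O R : Set X} {N : Set G} (hN : IsOpen N)
    (hneg : ∀ h ∈ N, -h ∈ N) (hO : IsOpen O) (hPO : P ⊆ O)
    (hP : ∀ x ∈ P, ∀ h ∈ N, h +ᵥ x ∈ O → h +ᵥ x ∈ P)
    (hR : ∀ᶠ z : P in residual P, z.1 ∈ R) :
    ∀ᶠ z : P in residual P, ∀ᶠ h in residual G, h ∈ N → h +ᵥ z.1 ∈ O → h +ᵥ z.1 ∈ R := by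
  refine eventually_residual_prod (p := fun z : P × G => z.2 ∈ N → z.2 +ᵥ z.1.1 ∈ O →
    z.2 +ᵥ z.1.1 ∈ R) ?_
  obtain ⟨S, hSo, hSd, hSc, hS⟩ := mem_residual_iff.1 hR
  have hΩ : IsOpen {z : P × G | z.2 ∈ N ∧ z.2 +ᵥ z.1.1 ∈ O} :=
    (hN.preimage continuous_snd).inter (hO.preimage (by fun_prop))
  have key : ∀ t ∈ S, ∀ᶠ z : P × G in residual (P × G), z.2 ∈ N ∧ z.2 +ᵥ z.1.1 ∈ O →
      z.2 +ᵥ z.1.1 ∈ ((↑) '' t : Set X) := by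
    intro t ht
    obtain ⟨D, hD, rfl⟩ := isOpen_induced_iff.1 (hSo t ht)
    have hev : ∀ᶠ z : P × G in residual (P × G),
        z ∈ {z : P × G | z.2 ∈ N ∧ z.2 +ᵥ z.1.1 ∈ O} → z ∈ {z : P × G | z.2 +ᵥ z.1.1 ∈ D} := by
      refine eventually_residual_of_open_subset hΩ (hD.preimage (by fun_prop)) ?_
      rintro ⟨z, h⟩ ⟨hh, hz⟩
      refine mem_closure_iff.2 fun W hW hzW => ?_
      obtain ⟨W', hW', rfl⟩ := (IsInducing.subtypeVal.prodMap (IsInducing.id (X := G))).isOpen_iff.1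
        hW
      -- The shear `(z, h) ↦ (h +ᵥ z, h)` turns the density claim into density of `D` in `P`.
      -- Symmetry of `N` brings the point found back into `P`.
      have hV : IsOpen {y : P | (-h +ᵥ y.1, h) ∈ W' ∧ -h +ᵥ y.1 ∈ O} :=
        (hW'.preimage (by fun_prop)).inter (hO.preimage (by fun_prop))
      obtain ⟨y, ⟨hy1, hy2⟩, hyD⟩ := (hSd _ ht).inter_open_nonempty _ hV
        ⟨⟨h +ᵥ z.1, hP z.1 z.2 h hh hz⟩, by simpa using hzW, by simpa using hPO z.2⟩
      refine ⟨(⟨-h +ᵥ y.1, hP y.1 y.2 (-h) (hneg h hh) hy2⟩, h), hy1, ⟨hh, ?_⟩, ?_⟩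
      · simpa using hPO y.2
      · simpa using hyD
    filter_upwards [hev] with z hz hz'
    exact ⟨⟨_, hP z.1.1 z.1.2 z.2 hz'.1 hz'.2⟩, hz hz', rfl⟩
  filter_upwards [(eventually_countable_ball hSc).2 key] with z hz h1 h2
  exact hS (a := ⟨_, hP z.1.1 z.1.2 z.2 h1 h2⟩) (mem_sInter.2 fun t ht => by
    obtain ⟨y, hy, hyz⟩ := hz t ht ⟨h1, h2⟩
    convert hy
    exact hyz.symm)

/-- The action map is a projection composed with a shear homeomorphism, hence open, so comeager sets
pull back to comeager sets and Kuratowski–Ulam applies. -/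
theorem eventually_residual_vadd [IsTopologicalAddGroup G] [ContinuousVAdd G X]
    [SecondCountableTopology G] {R : Set X} (hR : R ∈ residual X) :
    ∀ᶠ x in residual X, ∀ᶠ h in residual G, (h : G) +ᵥ x ∈ R := by
  have ho : IsOpenMap fun z : X × G => z.2 +ᵥ z.1 := by
    let e : X × G ≃ₜ X × G :=
      { toFun := fun z => (z.2 +ᵥ z.1, z.2)
        invFun := fun z => (-z.2 +ᵥ z.1, z.2)
        left_inv := fun z => by simp
        right_inv := fun z => by simp
        continuous_toFun := by fun_prop
        continuous_invFun :=
          (continuous_snd.neg.vadd continuous_fst).prodMk continuous_snd }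
    exact isOpenMap_fst.comp e.isOpenMap
  exact eventually_residual_prod (tendsto_residual_of_isOpenMap (by fun_prop) ho hR)

end Action

/-! ### Coding Borel maps by open sets -/

/-- The set of indices of those members of a sequence of sets that contain a given point. -/
def membershipCode {X : Type*} (O : ℕ → Set X) (x : X) : Set ℕ := {m | x ∈ O m}

theorem IsGδ.membershipCode_eq {X : Type*} [TopologicalSpace X]
    [TopologicalSpace.PseudoMetrizableSpace X]
    {O : ℕ → Set X} (hO : ∀ m, IsOpen (O m)) (s : Set ℕ) : IsGδ {x | membershipCode O x = s} := by
  classical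
  have : {x | membershipCode O x = s} = ⋂ m, if m ∈ s then O m else (O m)ᶜ := by
    ext x
    simp only [membershipCode, mem_ofPred_eq, Set.ext_iff, mem_iInter]
    refine forall_congr' fun m => ?_
    split_ifs with h <;> simp [h]
  rw [this]
  let := TopologicalSpace.pseudoMetrizableSpaceUniformity X
  have := TopologicalSpace.pseudoMetrizableSpaceUniformity_countably_generated X
  refine .iInter fun m => ?_
  split_ifs
  · exact (hO m).isGδ
  · exact (hO m).isClosed_compl.isGδ

/-- A Borel map to a standard Borel space has, on a dense `Gδ` set, the same fibres as a sequence
of open sets. -/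
theorem Measurable.exists_membershipCode {X Y : Type*} [TopologicalSpace X] [BaireSpace X]
    [MeasurableSpace X] [BorelSpace X] [MeasurableSpace Y] [StandardBorelSpace Y] {f : X → Y}
    (hf : Measurable f) :
    ∃ O : ℕ → Set X, (∀ m, IsOpen (O m)) ∧ ∃ C ∈ residual X, ∀ x ∈ C, ∀ y ∈ C,
      (membershipCode O x = membershipCode O y ↔ f x = f y) := by
  -- Preimages of a countable point-separating family have the Baire property; `C` is where all of
  -- them agree with their open approximations.
  have h (m : ℕ) : ∃ U : Set X, IsOpen U ∧
      f ⁻¹' (MeasurableSpace.natGeneratingSequence Y m) =ᵇ U :=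
    (hf (MeasurableSpace.measurableSet_natGeneratingSequence m)).residualEq_isOpen
  choose O hO hfO using h
  refine ⟨O, hO, _, eventually_countable_forall.2 fun m => eventuallyEq_set.1 (hfO m), ?_⟩
  intro x hx y hy
  have hcode : membershipCode O x = membershipCode O y ↔
      ∀ m, (f x ∈ MeasurableSpace.natGeneratingSequence Y m ↔
        f y ∈ MeasurableSpace.natGeneratingSequence Y m) := by
    rw [Set.ext_iff]
    exact forall_congr' fun m => iff_congr (hx m).symm (hy m).symm
  rw [hcode, ← (MeasurableSpace.injective_mapNatBool Y).eq_iff, funext_iff]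
  exact forall_congr' fun m => decide_eq_decide.symm

/-! ### Free stormy actions are not essentially countable -/

section Action

variable {G X : Type*} [AddCommGroup G] [TopologicalSpace G] [IsTopologicalAddGroup G]
  [PolishSpace G] [TopologicalSpace X] [PolishSpace X] [AddAction G X] [ContinuousVAdd G X]

/-- If the code takes countably many values on generic parts of orbits, then it is locally
generically constant. -/
theorem exists_generically_constant [Nonempty X] {O : ℕ → Set X}
    (hO : ∀ m, IsOpen (O m)) {C : Set X} (hC : C ∈ residual X)
    (hcount : ∀ x, ∃ S : Set (Set ℕ), S.Countable ∧
      ∀ g : G, g +ᵥ x ∈ C → membershipCode O (g +ᵥ x) ∈ S) :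
    ∃ V : Set G, IsOpen V ∧ V.Nonempty ∧ ∃ U : Set X, IsOpen U ∧ U.Nonempty ∧
      ∀ᶠ x in residual X, x ∈ U →
        ∃ s, ∀ᶠ g in residual G, g ∈ V → membershipCode O (g +ᵥ x) = s := by
  borelize G X
  have horbit : ∀ᶠ x in residual X, ∃ V ∈ TopologicalSpace.countableBasis G,
      ∃ s, ∀ᶠ g in residual G, g ∈ V → membershipCode O (g +ᵥ x) = s := by
    filter_upwards [eventually_residual_vadd (G := G) hC] with x hx
    by_contra hcon
    obtain ⟨S, hS, hSx⟩ := hcount x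
    -- Without local constancy every level set of the code is meager by the Baire property, yet
    -- countably many of them cover a comeager set.
    have hne : ∀ s ∈ S, ∀ᶠ g in residual G, membershipCode O (g +ᵥ x) ≠ s := by
      intro s _
      have hm : MeasurableSet {g : G | membershipCode O (g +ᵥ x) = s} :=
        (show Measurable fun g : G => g +ᵥ x from Continuous.measurable (by fun_prop))
          (IsGδ.membershipCode_eq hO s).measurableSet
      obtain ⟨V, hV, hVe⟩ := hm.residualEq_isOpen
      have hVe' := eventuallyEq_set.1 hVe
      rcases V.eq_empty_or_nonempty with rfl | ⟨g, hg⟩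
      · filter_upwards [hVe'] with g hg h using (hg.1 h).elim
      · obtain ⟨B, hB, hgB, hBV⟩ :=
          (TopologicalSpace.isBasis_countableBasis G).exists_subset_of_mem_open hg hV
        refine absurd ⟨B, hB, s, ?_⟩ hcon
        filter_upwards [hVe'] with g hg h using hg.2 (hBV h)
    obtain ⟨g, -, h1, h2⟩ := (hx.and ((eventually_countable_ball hS).2 hne)).exists_mem_of_isOpen
      isOpen_univ univ_nonempty
    exact h2 _ (hSx g h1) rfl
  by_contra hcon
  have hne : ∀ V ∈ TopologicalSpace.countableBasis G, ∀ᶠ x in residual X,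
      ¬ ∃ s, ∀ᶠ g in residual G, g ∈ V → membershipCode O (g +ᵥ x) = s := by
    intro V hV
    have hVo := TopologicalSpace.isOpen_of_mem_countableBasis hV
    have hm : MeasurableSet {x : X | ∃ s, ∀ᶠ g in residual G, g ∈ V →
        membershipCode O (g +ᵥ x) = s} := by
      -- Deciding each coordinate of the code separately removes the quantifier over `s` and shows
      -- that the set is Borel.
      have : {x : X | ∃ s, ∀ᶠ g in residual G, g ∈ V → membershipCode O (g +ᵥ x) = s} =
          ⋂ m, ({x : X | ∀ᶠ g in residual G, g ∈ V → g +ᵥ x ∈ O m} ∪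
            {x : X | ∀ᶠ g in residual G, g ∈ V → g +ᵥ x ∈ (O m)ᶜ}) := by
        ext x
        simp only [mem_iInter, mem_union, mem_ofPred_eq]
        constructor
        · rintro ⟨s, hs⟩ m
          by_cases hm : m ∈ s
          · left
            filter_upwards [hs] with g hg h
            exact (Set.ext_iff.1 (hg h) m).2 hm
          · right
            filter_upwards [hs] with g hg h h'
            exact hm ((Set.ext_iff.1 (hg h) m).1 h')
        · intro hx
          refine ⟨{m | ∀ᶠ g in residual G, g ∈ V → g +ᵥ x ∈ O m}, ?_⟩
          have : ∀ m, ∀ᶠ g in residual G, g ∈ V →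
              (g +ᵥ x ∈ O m ↔ ∀ᶠ g in residual G, g ∈ V → g +ᵥ x ∈ O m) := by
            intro m
            by_cases hm : ∀ᶠ g in residual G, g ∈ V → g +ᵥ x ∈ O m
            · filter_upwards [hm] with g hg h using iff_of_true (hg h) hm
            · filter_upwards [(hx m).resolve_left hm] with g hg h using iff_of_false (hg h) hm
          filter_upwards [eventually_countable_forall.2 this] with g hg h
          ext m
          exact hg m h
      rw [this]
      let := TopologicalSpace.upgradeIsCompletelyMetrizable X
      exact .iInter fun m => ((hO m).isGδ.vaught hVo).measurableSet.union
        ((hO m).isClosed_compl.isGδ.vaught hVo).measurableSet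
    obtain ⟨U, hU, hUe⟩ := hm.residualEq_isOpen
    have hUe' := eventuallyEq_set.1 hUe
    rcases U.eq_empty_or_nonempty with rfl | hUn
    · filter_upwards [hUe'] with x hx h using (hx.1 h).elim
    · refine absurd ⟨V, hVo, TopologicalSpace.nonempty_of_mem_countableBasis hV, U, hU, hUn, ?_⟩
        hcon
      filter_upwards [hUe'] with x hx h using hx.2 h
  obtain ⟨x, -, ⟨V, hV, h1⟩, h2⟩ := (horbit.and ((eventually_countable_ball
    (TopologicalSpace.countable_countableBasis G)).2 hne)).exists_mem_of_isOpen
      isOpen_univ univ_nonempty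
  exact h2 V hV h1

/-- An invariant form of `exists_generically_constant`. -/
theorem exists_invariant_generically_constant [Nonempty X] {O : ℕ → Set X}
    (hO : ∀ m, IsOpen (O m)) {C : Set X} (hC : C ∈ residual X)
    (hcount : ∀ x, ∃ S : Set (Set ℕ), S.Countable ∧
      ∀ g : G, g +ᵥ x ∈ C → membershipCode O (g +ᵥ x) ∈ S) :
    ∃ N : Set G, IsOpen N ∧ 0 ∈ N ∧ (∀ h ∈ N, -h ∈ N) ∧ ∃ U : Set X, IsOpen U ∧
      ∃ K : Set X, IsGδ K ∧ (U ∩ K).Nonempty ∧ (∀ x ∈ K, ∀ g : G, g +ᵥ x ∈ K) ∧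
      (∀ x ∈ K, ∀ᶠ g : G in residual G, g +ᵥ x ∈ C) ∧
      ∀ x ∈ U, x ∈ K → ∃ s, ∀ᶠ g in residual G, g ∈ N → membershipCode O (g +ᵥ x) = s := by
  obtain ⟨V, hV, ⟨v, hv⟩, U, hU, hUn, hgood⟩ := exists_generically_constant hO hC hcount
  obtain ⟨D, hDsub, hDG, hDd⟩ := mem_residual.1 (hgood.and hC)
  have hv0 : (fun x => v + x) ⁻¹' V ∈ 𝓝 (0 : G) :=
    (hV.preimage (by fun_prop)).mem_nhds (by simpa using hv)
  obtain ⟨N, hNo, hN0, hN2⟩ := exists_open_nhds_zero_add_subset hv0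
  let N' : Set G := N ∩ -N
  have hKo : IsGδ {x : X | ∀ᶠ g in residual G, g ∈ (univ : Set G) → g +ᵥ x ∈ D} :=
    hDG.vaught isOpen_univ
  have hKd := eventually_residual_vadd (G := G) (residual_of_dense_Gδ hDG hDd)
  simp only [mem_univ, true_imp_iff] at hKo
  have hU' : IsOpen {x : X | -v +ᵥ x ∈ U} := hU.preimage (by fun_prop)
  refine ⟨N', hNo.inter hNo.neg, ⟨hN0, by simpa using hN0⟩, fun h hh => ⟨hh.2, by simpa using hh.1⟩,
    {x | -v +ᵥ x ∈ U}, hU', _, hKo, ?_, ?_, ?_, ?_⟩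
  · obtain ⟨x, hx⟩ := hUn
    exact hKd.exists_mem_of_isOpen hU' ⟨v +ᵥ x, by simpa using hx⟩
  · intro x hx g
    filter_upwards [eventually_residual_add hx g] with h hh
    rwa [vadd_vadd]
  · intro x hx
    filter_upwards [hx] with g hg using (hDsub hg).2
  · intro x hxU hx
    have hxU' : {g : G | g +ᵥ (-v +ᵥ x) ∈ U} ∈ 𝓝 (0 : G) :=
      (hU.preimage (by fun_prop)).mem_nhds (by simpa using hxU)
    obtain ⟨W, hWU, hWo, hW0⟩ := mem_nhds_iff.1 hxU'
    -- A small `g` moves `-v +ᵥ x` to a generic point still in `U`. Its window `V` then contains `h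
    -- + v - g` for all `h ∈ N'`, because `N + N` lies in `V - v`.
    obtain ⟨g, ⟨hgW, hgN⟩, hg⟩ := (eventually_residual_add hx (-v)).exists_mem_of_isOpen
      (hWo.inter (hNo.inter hNo.neg)) ⟨0, hW0, hN0, by simpa using hN0⟩
    obtain ⟨s, hs⟩ := (hDsub hg).1 (by simpa [vadd_vadd] using hWU hgW)
    refine ⟨s, ?_⟩
    filter_upwards [eventually_residual_add hs (v - g)] with h hh hhN
    have := hh (by
      have := hN2 (add_mem_add hhN.1 hgN.2)
      simpa [sub_eq_add_neg, add_comm, add_left_comm, add_assoc] using this)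
    rw [vadd_vadd] at this
    convert this using 2
    congr 1
    abel

/-- In a free action, a locally invariant `Gδ` piece of a single orbit contains a point at which
the orbit map is locally open. -/
theorem exists_orbit_map_open_of_locally_invariant
    (hfree : IsFreeAction G X) {P U : Set X} {N : Set G}
    (hN : IsOpen N) (hneg : ∀ h ∈ N, -h ∈ N) (hU : IsOpen U) (hPU : P ⊆ U)
    (hinv : ∀ x ∈ P, ∀ h ∈ N, h +ᵥ x ∈ U → h +ᵥ x ∈ P) (hPG : IsGδ P) (hne : P.Nonempty)
    {x₀ : X} (horb : ∀ x ∈ P, ∃ g : G, g +ᵥ x₀ = x) :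
    ∃ x : X, ∀ W ∈ 𝓝 (0 : G), ∃ A ∈ 𝓝 x, ∀ g ∈ N, g +ᵥ x ∈ A → g ∈ W := by
  have hinj : Function.Injective fun g : G => g +ᵥ x₀ := by
    intro g h hgh
    by_contra hne
    refine hfree (g - h) (sub_ne_zero.2 hne) (h +ᵥ x₀) ?_
    simpa [vadd_vadd] using hgh
  borelize G X
  have hP : PolishSpace P := hPG.polishSpace
  have hPn : Nonempty P := hne.to_subtype
  obtain ⟨W, hW⟩ := (𝓝 (0 : G)).exists_antitone_basis
  let d := TopologicalSpace.denseSeq G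
  -- These are orbit images of small open sets around a dense sequence. They are Borel by
  -- Lusin–Souslin, and so relatively open in `P` up to a meager set.
  let T : ℕ → ℕ → Set X := fun k n => (fun g : G => g +ᵥ x₀) '' {g | g - d n ∈ interior (W k)}
  have hT (k n : ℕ) : MeasurableSet (T k n) :=
    (isOpen_interior.preimage (by fun_prop)).measurableSet.image_of_continuousOn_injOn
      (Continuous.continuousOn (by fun_prop)) hinj.injOn
  have hTe (k n : ℕ) : ∃ A : Set P, IsOpen A ∧ (fun z : P => z.1) ⁻¹' T k n =ᵇ A :=
    (measurable_subtype_coe (hT k n)).residualEq_isOpen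
  choose A hA hTA using hTe
  have hR : ∀ᶠ z : P in residual P, z.1 ∈ {x | ∃ h : x ∈ P, ∀ k n, x ∈ T k n ↔ ⟨x, h⟩ ∈ A k n} := by
    filter_upwards [eventually_countable_forall.2 fun k => eventually_countable_forall.2 fun n =>
      eventuallyEq_set.1 (hTA k n)] with z hz using ⟨z.2, hz⟩
  obtain ⟨x, -, ⟨hxP, hxR⟩, hx⟩ := (hR.and (eventually_residual_vadd_of_locally_invariant hN hneg hU
    hPU hinv hR)).exists_mem_of_isOpen isOpen_univ univ_nonempty
  refine ⟨x, fun W₀ hW₀ => ?_⟩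
  obtain ⟨k, hk⟩ : ∃ k, ∀ a ∈ W k, ∀ b ∈ W k, ∀ c ∈ W k, a - b - c ∈ W₀ := by
    have hc : Continuous fun p : G × G × G => p.1 - p.2.1 - p.2.2 := by fun_prop
    have hlim : (fun p : G × G × G => p.1 - p.2.1 - p.2.2) ⁻¹' W₀ ∈ 𝓝 (0, 0, 0) :=
      hc.continuousAt (by simpa using hW₀)
    obtain ⟨u, hu, v, hv, huv⟩ := mem_nhds_prod_iff.1 hlim
    obtain ⟨v₁, hv₁, v₂, hv₂, hv₁₂⟩ := mem_nhds_prod_iff.1 hv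
    obtain ⟨k, -, hk⟩ := hW.1.mem_iff.1 (inter_mem hu (inter_mem hv₁ hv₂))
    exact ⟨k, fun a ha b hb c hc => huv (show (a, b, c) ∈ _ from
      ⟨(hk ha).1, hv₁₂ ⟨(hk hb).2.1, (hk hc).2.2⟩⟩)⟩
  obtain ⟨n, hn⟩ : ∃ n, x.1 ∈ T k n := by
    have hWk : 0 ∈ interior (W k) := mem_interior_iff_mem_nhds.2 (hW.1.mem_of_mem trivial)
    obtain ⟨g, hg⟩ := horb x.1 x.2
    obtain ⟨n, hn⟩ := (TopologicalSpace.denseRange_denseSeq G).exists_mem_open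
      (isOpen_interior.preimage (by fun_prop : Continuous fun y => g - y))
      ⟨g, by simpa using hWk⟩
    exact ⟨n, g, hn, hg⟩
  obtain ⟨A', hA', hAA'⟩ := isOpen_induced_iff.1 (hA k n)
  have hxA' : x.1 ∈ A' := by
    have : x ∈ A k n := (hxR k n).1 hn
    rwa [← hAA'] at this
  refine ⟨A' ∩ U, (hA'.inter hU).mem_nhds ⟨hxA', hPU x.2⟩, fun g hg hgA => ?_⟩
  -- Since `g` itself need not be generic, it is perturbed by `h ∈ W k`. Then `x` and `(h + g) +ᵥ x`
  -- both lie in `T k n`, and `g = (a - d n) - (b - d n) - h` is small.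
  have hnear : {h : G | h + g ∈ N ∧ h +ᵥ (g +ᵥ x.1) ∈ A' ∩ U ∧ h ∈ W k} ∈ 𝓝 (0 : G) := by
    refine inter_mem ((hN.preimage (by fun_prop)).mem_nhds (by simpa using hg))
      (inter_mem (((hA'.inter hU).preimage (by fun_prop)).mem_nhds (by simpa using hgA))
        (hW.1.mem_of_mem trivial))
  obtain ⟨B, hB, hBo, hB0⟩ := mem_nhds_iff.1 hnear
  obtain ⟨h, hhB, hh⟩ := (eventually_residual_add hx g).exists_mem_of_isOpen hBo ⟨0, hB0⟩
  obtain ⟨h1, h2, h3⟩ := hB hhB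
  rw [vadd_vadd] at h2
  obtain ⟨hhP, hhR⟩ := hh h1 h2.2
  obtain ⟨a, ha, hax⟩ := (hhR k n).2 (by rw [← hAA']; exact h2.1)
  obtain ⟨b, hb, hbx⟩ := hn
  have hgab : a = h + g + b := hinj (by
    simp only at hax hbx ⊢
    rw [hax, ← hbx, vadd_vadd])
  convert hk _ (interior_subset ha) _ (interior_subset hb) h h3 using 1
  rw [hgab]
  abel

/-- A free stormy continuous action of an abelian Polish group on a nonempty Polish space induces
an orbit equivalence relation that is not essentially countable. -/
theorem IsStormy.not_isEssentiallyCountable {G : Type*} {X : Type u} [AddCommGroup G]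
    [TopologicalSpace G] [IsTopologicalAddGroup G] [PolishSpace G] [TopologicalSpace X]
    [PolishSpace X] [MeasurableSpace X] [BorelSpace X] [AddAction G X] [ContinuousVAdd G X]
    [Nonempty X] (hstormy : IsStormy G X) (hfree : IsFreeAction G X) :
    ¬ IsEssentiallyCountable.{u, v} (AddAction.orbitRel G X) := by
  rintro ⟨Y, _, _, F, hF, f, hf, hred⟩
  obtain ⟨O, hO, C, hC, hcode⟩ := hf.exists_membershipCode
  have hcount : ∀ x, ∃ S : Set (Set ℕ), S.Countable ∧
      ∀ g : G, g +ᵥ x ∈ C → membershipCode O (g +ᵥ x) ∈ S := by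
    intro x
    -- An orbit maps into one class of `F`, and on `C` the code depends only on the value of `f`.
    have hc : (f '' {y | y ∈ C ∧ ∃ g : G, g +ᵥ x = y}).Countable := by
      refine (hF.countable_classes (f x)).mono ?_
      rintro _ ⟨y, ⟨-, g, rfl⟩, rfl⟩
      exact (hred _ _).1 (Setoid.symm' _ ⟨g, rfl⟩)
    refine ⟨_, hc.image fun y =>
      membershipCode O (Function.invFunOn f {y | y ∈ C ∧ ∃ g : G, g +ᵥ x = y} y), ?_⟩
    intro g hg
    have hmem : ∃ z ∈ {y | y ∈ C ∧ ∃ g : G, g +ᵥ x = y}, f z = f (g +ᵥ x) :=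
      ⟨_, ⟨hg, g, rfl⟩, rfl⟩
    exact ⟨_, ⟨_, ⟨hg, g, rfl⟩, rfl⟩,
      (hcode _ (Function.invFunOn_mem hmem).1 _ hg).2 (Function.invFunOn_eq hmem)⟩
  obtain ⟨N, hN, hN0, hneg, U, hU, K, hK, ⟨x₀, hx₀U, hx₀K⟩, hKinv, hKC, hconst⟩ :=
    exists_invariant_generically_constant (G := G) hO hC hcount
  obtain ⟨s, hs⟩ := hconst x₀ hx₀U hx₀K
  let P : Set X := U ∩ K ∩ {x | ∀ᶠ g in residual G, g ∈ N → g +ᵥ x ∈ {x | membershipCode O x = s}}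
  have hPG : IsGδ P := (hU.isGδ.inter hK).inter ((IsGδ.membershipCode_eq hO s).vaught hN)
  have hinv : ∀ x ∈ P, ∀ h ∈ N, h +ᵥ x ∈ U → h +ᵥ x ∈ P := by
    rintro x ⟨⟨hxU, hxK⟩, hx⟩ h hh hhU
    simp only [mem_ofPred_eq] at hx
    obtain ⟨t, ht⟩ := hconst _ hhU (hKinv x hxK h)
    have ht' := eventually_residual_add ht (-h)
    -- The windows of `x` and `h +ᵥ x` overlap near `h`, so their generic codes coincide.
    obtain ⟨g, ⟨hgN, hgh⟩, h1, h2⟩ := (hx.and ht').exists_mem_of_isOpen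
      (hN.inter (hN.preimage (continuous_add_const (-h)))) ⟨h, hh, by simpa using hN0⟩
    have hts : s = t := by
      rw [← h1 hgN, ← h2 hgh, vadd_vadd]
      simp
    exact ⟨⟨hhU, hKinv x hxK h⟩, hts ▸ ht⟩
  have horb : ∀ x ∈ P, ∃ g : G, g +ᵥ x₀ = x := by
    rintro x ⟨⟨hxU, hxK⟩, hx⟩
    simp only [mem_ofPred_eq] at hx
    obtain ⟨g, hg, h1, h2⟩ := (hx.and (hKC x hxK)).exists_mem_of_isOpen hN ⟨0, hN0⟩
    obtain ⟨g', hg', h1', h2'⟩ := (hs.and (hKC x₀ hx₀K)).exists_mem_of_isOpen hN ⟨0, hN0⟩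
    -- Translates of `x` and `x₀` in `C` share the code `s`, hence the value of `f`, hence the
    -- orbit.
    have hE := (hred _ _).2 (Eq.subst (motive := fun y => F (f (g +ᵥ x)) y)
      ((hcode _ h2 _ h2').1 ((h1 hg).trans (h1' hg').symm)) (F.refl' _))
    obtain ⟨k, hk⟩ := AddAction.orbitRel_apply.1 hE
    refine ⟨-g + (k + g'), ?_⟩
    simp only [add_vadd]
    simp only at hk
    rw [hk, neg_vadd_vadd]
  obtain ⟨x, hx⟩ := exists_orbit_map_open_of_locally_invariant hfree hN hneg hU
    (fun x hx => hx.1.1) hinv hPG ⟨x₀, ⟨hx₀U, hx₀K⟩, hs⟩ horb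
  obtain ⟨V, hVo, hV0, hVN⟩ := exists_open_nhds_zero_add_subset (hN.mem_nhds hN0)
  let V' : Set G := V ∩ -V
  refine hstormy V' (hVo.inter hVo.neg) ⟨0, hV0, by simpa using hV0⟩ x ?_
  rw [isOpenMap_iff_nhds_le]
  rintro ⟨g, hg⟩ S hS
  obtain ⟨u, hu, huS⟩ := (mem_nhds_subtype _ _ _).1 hS
  obtain ⟨A, hA, hAu⟩ := hx ((fun w => w + g) ⁻¹' u)
    ((continuous_add_const g).continuousAt (by simpa using hu))
  refine (mem_nhds_subtype _ _ _).2 ⟨(fun y => -g +ᵥ y) ⁻¹' A,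
    (continuous_const_vadd (-g)).continuousAt (by simpa [imageFactorization] using hA), ?_⟩
  rintro ⟨_, g', hg', rfl⟩ hy
  refine huS (a := ⟨g', hg'⟩) ?_
  have := hAu (-g + g') (hVN (add_mem_add hg.2 hg'.1)) (by simpa [add_vadd] using hy)
  simpa using this

end Action

/-! ### The Polish space of 1-Lipschitz maps -/

namespace LipOne

variable {Z : Type u} [NormedAddCommGroup Z]

@[simp]
theorem vadd_apply (ζ : Z) (f : LipOne Z) (z : Z) : (ζ +ᵥ f).1 z = f.1 (ζ + z) := rfl

theorem abs_sub_le (f : LipOne Z) (x y : Z) : |f.1 x - f.1 y| ≤ ‖x - y‖ := by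
  simpa [Real.dist_eq, dist_eq_norm] using f.2.dist_le_mul x y

@[fun_prop]
theorem continuous_eval (z : Z) : Continuous fun f : LipOne Z => f.1 z :=
  (continuous_apply z).comp continuous_subtype_val

theorem continuous_eval_prod : Continuous fun p : Z × LipOne Z => p.2.1 p.1 := by
  refine continuous_iff_continuousAt.2 fun ⟨z, f⟩ => ?_
  have h1 : Tendsto (fun p : Z × LipOne Z => p.2.1 p.1 - p.2.1 z) (𝓝 (z, f)) (𝓝 0) := by
    refine squeeze_zero_norm (a := fun p => ‖p.1 - z‖) (fun p => p.2.abs_sub_le _ _) ?_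
    have : Continuous fun p : Z × LipOne Z => ‖p.1 - z‖ := by fun_prop
    simpa using this.tendsto (z, f)
  have h2 : Tendsto (fun p : Z × LipOne Z => p.2.1 z) (𝓝 (z, f)) (𝓝 (f.1 z)) :=
    ((continuous_eval z).comp continuous_snd).tendsto (z, f)
  simpa [ContinuousAt] using h1.add h2

instance : ContinuousVAdd Z (LipOne Z) where
  continuous_vadd := by
    refine Continuous.subtype_mk (continuous_pi fun z => ?_) _
    exact continuous_eval_prod.comp
      ((continuous_fst.add continuous_const).prodMk continuous_snd :
        Continuous fun p : Z × LipOne Z => (p.1 + z, p.2))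

instance : Nonempty (LipOne Z) := ⟨⟨fun _ => 0, LipschitzWith.const' 0⟩⟩

/-- Restriction to a dense sequence is a closed embedding: evaluations elsewhere are uniform limits
of those on the sequence, and McShane extension identifies the range by closed Lipschitz
inequalities. -/
instance [TopologicalSpace.SeparableSpace Z] : PolishSpace (LipOne Z) := by
  let d := TopologicalSpace.denseSeq Z
  have hd := TopologicalSpace.denseRange_denseSeq Z
  let e : LipOne Z → ℕ → ℝ := fun f n => f.1 (d n)
  have he : Continuous e := continuous_pi fun n => continuous_eval (d n)
  have hind : IsInducing e := by
    refine ⟨le_antisymm he.le_induced ?_⟩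
    let t : TopologicalSpace (LipOne Z) := .induced e inferInstance
    have het : Continuous[t, _] e := continuous_induced_dom
    refine continuous_iff_le_induced.1 (continuous_pi fun z => ?_ :
      Continuous[t, _] fun (f : LipOne Z) (z : Z) => f.1 z)
    refine continuous_of_uniform_approx_of_continuous fun u hu => ?_
    obtain ⟨ε, hε, hεu⟩ := Metric.mem_uniformity_dist.1 hu
    obtain ⟨n, hn⟩ := hd.exists_dist_lt z hε
    exact ⟨fun f => f.1 (d n), (continuous_apply n).comp het,
      fun f => hεu ((f.2.dist_le_mul z (d n)).trans_lt (by simpa using hn))⟩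
  refine IsClosedEmbedding.polishSpace (f := e) ⟨⟨hind, ?_⟩, ?_⟩
  · exact fun f g hfg => Subtype.ext
      (hd.equalizer f.2.continuous g.2.continuous hfg)
  · have : range e = {y | ∀ m n, |y m - y n| ≤ ‖d m - d n‖} := by
      ext y
      refine ⟨?_, fun hy => ?_⟩
      · rintro ⟨f, rfl⟩ m n
        exact f.abs_sub_le _ _
      · have hinv (z : Z) (hz : z ∈ range d) : d (Function.invFun d z) = z :=
          Function.invFun_eq hz
        have hl : LipschitzOnWith 1 (fun z => y (Function.invFun d z)) (range d) := by
          refine LipschitzOnWith.of_dist_le_mul fun a ha b hb => ?_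
          have := hy (Function.invFun d a) (Function.invFun d b)
          rw [hinv a ha, hinv b hb] at this
          simpa [Real.dist_eq, dist_eq_norm] using this
        obtain ⟨f, hf, hfy⟩ := hl.extend_real
        refine ⟨⟨f, hf⟩, funext fun n => ?_⟩
        have h1 := hy (Function.invFun d (d n)) n
        rw [hinv _ ⟨n, rfl⟩, sub_self, norm_zero] at h1
        have h2 : f (d n) = y (Function.invFun d (d n)) := (hfy ⟨n, rfl⟩).symm
        exact h2.trans (sub_eq_zero.1 (abs_nonpos_iff.1 h1))
    rw [this]
    simp only [ofPred_forall]
    exact isClosed_iInter fun m => isClosed_iInter fun n =>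
      isClosed_le (by fun_prop) continuous_const

/-- Open sets of `LipOne Z` are determined by approximation on finite sets. -/
theorem exists_finset_of_isOpen {U : Set (LipOne Z)} (hU : IsOpen U) {f : LipOne Z} (hf : f ∈ U) :
    ∃ F : Finset Z, ∃ ε > 0, ∀ g : LipOne Z, (∀ z ∈ F, |g.1 z - f.1 z| < ε) → g ∈ U := by
  obtain ⟨U', hU', rfl⟩ := isOpen_induced_iff.1 hU
  obtain ⟨F, u, hu, hFu⟩ := isOpen_pi_iff.1 hU' f.1 hf
  have hev : ∀ᶠ ε in 𝓝[>] (0 : ℝ), ∀ z ∈ F, Metric.ball (f.1 z) ε ⊆ u z := by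
    refine (eventually_all_finset F).2 fun z hz => ?_
    obtain ⟨r, hr, hru⟩ := Metric.isOpen_iff.1 (hu z hz).1 _ (hu z hz).2
    filter_upwards [Ioo_mem_nhdsGT hr] with ε hε
    exact (Metric.ball_subset_ball hε.2.le).trans hru
  obtain ⟨ε, hε, hε0⟩ := (hev.and self_mem_nhdsWithin).exists
  exact ⟨F, ε, hε0, fun g hg => hFu fun z hz => hε z hz (hg z hz)⟩

theorem dense_of_forall_finset {S : Set (LipOne Z)}
    (h : ∀ (f : LipOne Z) (F : Finset Z), ∃ g ∈ S, ∀ z ∈ F, g.1 z = f.1 z) : Dense S := by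
  refine dense_iff_inter_open.2 fun U hU ⟨f, hf⟩ => ?_
  obtain ⟨F, ε, hε, hF⟩ := exists_finset_of_isOpen hU hf
  obtain ⟨g, hg, hgf⟩ := h f F
  exact ⟨g, hF g fun z hz => by simpa [hgf z hz] using hε, hg⟩

/-! ### Modifying 1-Lipschitz maps off finite sets -/

variable {𝕜 : Type w} [RCLike 𝕜] [NormedSpace 𝕜 Z]

/-- A 1-Lipschitz map can be modified off a finite set so as to increase at full speed along a
given vector. -/
theorem exists_eqOn_and_abs_sub_eq_norm (𝕜 : Type w) [RCLike 𝕜] [NormedSpace 𝕜 Z] [Nontrivial Z]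
    (f : LipOne Z) (F : Finset Z) (ζ : Z) :
    ∃ g : LipOne Z, (∀ z ∈ F, g.1 z = f.1 z) ∧ ∃ z, |g.1 (ζ + z) - g.1 z| = ‖ζ‖ := by
  obtain ⟨L, hL⟩ : ∃ L : ℝ, ∀ a ∈ F, |f.1 a| + ‖a‖ ≤ L :=
    ⟨∑ a ∈ F, (|f.1 a| + ‖a‖), fun a ha =>
      Finset.single_le_sum (f := fun a => |f.1 a| + ‖a‖) (fun _ _ => by positivity) ha⟩
  -- A cone with apex value `L + ‖ζ‖` at `w` lies below `f` on `F` because `w` is so far away.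
  -- Truncating `f` at `L` lets the cone prevail at `w` and `ζ + w`.
  obtain ⟨w, hw⟩ := NormedSpace.exists_lt_norm 𝕜 Z (L + ‖ζ‖ + L)
  have hl : LipschitzWith 1 fun x => L + ‖ζ‖ - dist x w := by
    simpa using (LipschitzWith.const' (K := 0) (L + ‖ζ‖)).sub (LipschitzWith.dist_left w)
  have hg : LipschitzWith 1 fun x => max (min (f.1 x) L) (L + ‖ζ‖ - dist x w) := by
    simpa using (f.2.min_const L).max hl
  refine ⟨⟨_, hg⟩, fun a ha => ?_, w, ?_⟩
  · have h1 := hL a ha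
    have h2 := le_abs_self (f.1 a)
    have h3 := neg_abs_le (f.1 a)
    have h4 := norm_nonneg a
    have h5 : ‖w‖ ≤ ‖a‖ + dist a w := by
      rw [dist_comm, dist_eq_norm]
      exact norm_le_norm_add_norm_sub' w a
    simp only
    rw [min_eq_left (by linarith), max_eq_left (by linarith)]
  · have h1 : max (min (f.1 (ζ + w)) L) (L + ‖ζ‖ - dist (ζ + w) w) = L := by simp
    have h2 : max (min (f.1 w) L) (L + ‖ζ‖ - dist w w) = L + ‖ζ‖ := by
      rw [dist_self, sub_zero]
      exact max_eq_right ((min_le_right _ _).trans (by simp))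
    simp only
    rw [h1, h2]
    simp

/-- In an infinite-dimensional space, subtracting a suitable vector of given norm does not decrease
the norm of any of finitely many vectors. -/
theorem exists_norm_eq_and_norm_le_norm_sub (hZ : ¬ FiniteDimensional 𝕜 Z) (T : Finset Z) {r : ℝ}
    (hr : 0 ≤ r) : ∃ ζ : Z, ‖ζ‖ = r ∧ ∀ v ∈ T, ‖v‖ ≤ ‖v - ζ‖ := by
  choose φ hφ hφv using fun v : Z => exists_dual_vector'' 𝕜 v
  -- A vector `ξ` killed by all the norming functionals exists by dimension; then `φ v` still takes
  -- the value `‖v‖` at `v` minus any multiple of `ξ`.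
  let A : Z →ₗ[𝕜] T → 𝕜 := LinearMap.pi fun v => (φ v.1).toLinearMap
  have hA : ¬ Function.Injective A := fun h => hZ (.of_injective A h)
  obtain ⟨ξ, hξ, hξ0⟩ : ∃ ξ, A ξ = 0 ∧ ξ ≠ 0 := by
    simpa [injective_iff_map_eq_zero] using hA
  have hξn : ‖ξ‖ ≠ 0 := norm_ne_zero_iff.2 hξ0
  refine ⟨((r / ‖ξ‖ : ℝ) : 𝕜) • ξ, ?_, fun v hv => ?_⟩
  · rw [norm_smul, RCLike.norm_ofReal, abs_of_nonneg (by positivity), div_mul_cancel₀ _ hξn]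
  · have h0 : φ v ξ = 0 := congrFun hξ ⟨v, hv⟩
    calc ‖v‖ = ‖φ v (v - ((r / ‖ξ‖ : ℝ) : 𝕜) • ξ)‖ := by simp [h0, hφv]
      _ ≤ _ := by simpa using (φ v).le_of_opNorm_le (hφ v) (v - ((r / ‖ξ‖ : ℝ) : 𝕜) • ξ)

/-- In infinite dimensions, a 1-Lipschitz map can be modified off a finite set so as to be
invariant on that set under a translation of given length. -/
theorem exists_eqOn_and_translate_eqOn (hZ : ¬ FiniteDimensional 𝕜 Z) (f : LipOne Z)
    (F : Finset Z) {r : ℝ} (hr : 0 < r) :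
    ∃ g : LipOne Z, ∃ ζ : Z, ‖ζ‖ = r ∧ ∀ z ∈ F, g.1 z = f.1 z ∧ g.1 (ζ + z) = f.1 z := by
  classical
  obtain ⟨ζ, hζ, hsub⟩ := exists_norm_eq_and_norm_le_norm_sub hZ
    ((F ×ˢ F).image fun p => p.1 - p.2) hr.le
  have hF : ∀ a ∈ F, ∀ b ∈ F, ‖a - b‖ ≤ ‖a - (ζ + b)‖ := by
    intro a ha b hb
    have := hsub _ (Finset.mem_image.2 ⟨(a, b), Finset.mem_product.2 ⟨ha, hb⟩, rfl⟩)
    rwa [sub_sub, add_comm b] at this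
  have hdisj : ∀ b ∈ F, ζ + b ∉ F := by
    intro b hb hm
    have := hF _ hm b hb
    simp only [add_sub_cancel_right, sub_self, norm_zero, hζ] at this
    exact this.not_gt hr
  -- Copying `f` from `F` to its shift stays 1-Lipschitz, since by `hF` a point and a shifted point
  -- are no closer than the originals.
  let ψ : Z → ℝ := fun x => if x ∈ F then f.1 x else f.1 (x - ζ)
  have hψ1 : ∀ a ∈ F, ψ a = f.1 a := fun a ha => if_pos ha
  have hψ2 : ∀ a ∈ F, ψ (ζ + a) = f.1 a := fun a ha => by
    simp only [ψ, if_neg (hdisj a ha), add_sub_cancel_left]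
  have hψ : LipschitzOnWith 1 ψ (F ∪ (fun a => ζ + a) '' F) := by
    refine LipschitzOnWith.of_dist_le_mul ?_
    rintro x (hx | ⟨x, hx, rfl⟩) y (hy | ⟨y, hy, rfl⟩) <;>
      simp only [NNReal.coe_one, one_mul, dist_eq_norm, Finset.mem_coe] at hx hy ⊢
    · rw [hψ1 x hx, hψ1 y hy]
      exact f.abs_sub_le x y
    · rw [hψ1 x hx, hψ2 y hy]
      exact (f.abs_sub_le x y).trans (hF x hx y hy)
    · rw [hψ2 x hx, hψ1 y hy, norm_sub_rev, norm_sub_rev (ζ + x)]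
      exact (f.abs_sub_le y x).trans (hF y hy x hx)
    · rw [hψ2 x hx, hψ2 y hy, add_sub_add_left_eq_sub]
      exact f.abs_sub_le x y
  obtain ⟨g, hg, hgψ⟩ := hψ.extend_real
  refine ⟨⟨g, hg⟩, ζ, hζ, fun z hz => ⟨?_, ?_⟩⟩
  · exact (hgψ (Or.inl hz)).symm.trans (hψ1 z hz)
  · exact (hgψ (Or.inr ⟨z, hz, rfl⟩)).symm.trans (hψ2 z hz)

/-! ### The generic invariant set -/

/-- The maps that vary along each vector of a dense sequence by more than half its norm. -/
def varying (Z : Type u) [NormedAddCommGroup Z] [TopologicalSpace.SeparableSpace Z] :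
    Set (LipOne Z) :=
  {f | ∀ n, TopologicalSpace.denseSeq Z n ≠ 0 → ∃ z,
    ‖TopologicalSpace.denseSeq Z n‖ / 2 < |f.1 (TopologicalSpace.denseSeq Z n + z) - f.1 z|}

/-- The maps that have, at every scale, approximate periods on all finite sets. -/
def recurrent (Z : Type u) [NormedAddCommGroup Z] : Set (LipOne Z) :=
  {f | ∀ (F : Finset Z) (n : ℕ), ∀ ε > 0, ∃ ζ, 1 / (n + 1 : ℝ) < ‖ζ‖ ∧ ‖ζ‖ < 2 * (1 / (n + 1)) ∧
    ∀ z ∈ F, |f.1 (ζ + z) - f.1 z| < ε}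

theorem isOpen_varying (ζ : Z) :
    IsOpen {f : LipOne Z | ζ ≠ 0 → ∃ z, ‖ζ‖ / 2 < |f.1 (ζ + z) - f.1 z|} := by
  by_cases hζ : ζ = 0
  · simp [hζ]
  · simp only [ne_eq, hζ, not_false_eq_true, forall_const, ofPred_exists]
    exact isOpen_iUnion fun z => isOpen_lt continuous_const (by fun_prop)

theorem dense_varying (𝕜 : Type w) [RCLike 𝕜] [NormedSpace 𝕜 Z] (ζ : Z) :
    Dense {f : LipOne Z | ζ ≠ 0 → ∃ z, ‖ζ‖ / 2 < |f.1 (ζ + z) - f.1 z|} := by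
  by_cases hζ : ζ = 0
  · simp [hζ]
  have : Nontrivial Z := nontrivial_of_ne _ _ hζ
  refine dense_of_forall_finset fun f F => ?_
  obtain ⟨g, hg, z, hz⟩ := exists_eqOn_and_abs_sub_eq_norm 𝕜 f F ζ
  exact ⟨g, fun _ => ⟨z, (half_lt_self (norm_pos_iff.2 hζ)).trans_eq hz.symm⟩, hg⟩

theorem isOpen_recurrent (F : Finset Z) (δ ε : ℝ) : IsOpen {f : LipOne Z |
    ∃ ζ, δ < ‖ζ‖ ∧ ‖ζ‖ < 2 * δ ∧ ∀ z ∈ F, |f.1 (ζ + z) - f.1 z| < ε} := by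
  simp only [ofPred_exists, ofPred_and, ofPred_forall]
  refine isOpen_iUnion fun ζ => isOpen_const.inter (isOpen_const.inter ?_)
  exact isOpen_biInter_finset fun z _ => isOpen_lt (by fun_prop) continuous_const

theorem dense_recurrent (hZ : ¬ FiniteDimensional 𝕜 Z) (F : Finset Z) {δ ε : ℝ}
    (hδ : 0 < δ) (hε : 0 < ε) : Dense {f : LipOne Z |
      ∃ ζ, δ < ‖ζ‖ ∧ ‖ζ‖ < 2 * δ ∧ ∀ z ∈ F, |f.1 (ζ + z) - f.1 z| < ε} := by
  classical
  refine dense_of_forall_finset fun f F' => ?_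
  obtain ⟨g, ζ, hζ, hg⟩ := exists_eqOn_and_translate_eqOn hZ f (F ∪ F')
    (show 0 < 3 / 2 * δ by positivity)
  refine ⟨g, ⟨ζ, by linarith, by linarith, fun z hz => ?_⟩,
    fun z hz => (hg z (Finset.mem_union_right _ hz)).1⟩
  obtain ⟨h1, h2⟩ := hg z (Finset.mem_union_left _ hz)
  simpa [h1, h2] using hε

section Separable

variable [TopologicalSpace.SeparableSpace Z]

theorem varying_eq_iInter : varying Z = ⋂ n, {f | TopologicalSpace.denseSeq Z n ≠ 0 → ∃ z,
    ‖TopologicalSpace.denseSeq Z n‖ / 2 < |f.1 (TopologicalSpace.denseSeq Z n + z) - f.1 z|} :=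
  ofPred_forall _

open Classical in
theorem recurrent_eq_iInter : recurrent Z = ⋂ p : Finset ℕ × ℕ × ℕ,
    {f | ∃ ζ, 1 / (p.2.1 + 1 : ℝ) < ‖ζ‖ ∧ ‖ζ‖ < 2 * (1 / (p.2.1 + 1)) ∧
      ∀ z ∈ p.1.image (TopologicalSpace.denseSeq Z), |f.1 (ζ + z) - f.1 z| <
        1 / (p.2.2 + 1 : ℝ)} := by
  ext f
  simp only [mem_iInter, Prod.forall]
  constructor
  · intro hf F n m
    exact hf _ n (1 / (m + 1)) (by positivity)
  · intro hf F n ε hε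
    -- One third of `ε` is for the approximate period, the other two for moving `z` and `ζ + z` to
    -- the dense sequence.
    obtain ⟨m, hm⟩ := exists_nat_one_div_lt (show 0 < ε / 3 by positivity)
    choose i hi using fun z : Z => (TopologicalSpace.denseRange_denseSeq Z).exists_dist_lt z
      (show 0 < ε / 3 by positivity)
    obtain ⟨ζ, h1, h2, h3⟩ := hf (F.image i) n m
    refine ⟨ζ, h1, h2, fun z hz => ?_⟩
    have h4 := h3 _ (Finset.mem_image_of_mem _ (Finset.mem_image_of_mem _ hz))
    have h5 := f.abs_sub_le z (TopologicalSpace.denseSeq Z (i z))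
    have h6 := f.abs_sub_le (ζ + z) (ζ + TopologicalSpace.denseSeq Z (i z))
    have h7 := hi z
    rw [dist_eq_norm] at h7
    rw [add_sub_add_left_eq_sub] at h6
    rw [abs_le] at h5 h6
    rw [abs_lt] at h4 ⊢
    constructor <;> linarith

/-- The invariant set of recurrent maps that vary along all vectors. -/
def genericPart (Z : Type u) [NormedAddCommGroup Z] [TopologicalSpace.SeparableSpace Z] :
    SubAddAction Z (LipOne Z) where
  carrier := varying Z ∩ recurrent Z
  vadd_mem' := by
    classical
    rintro η f ⟨hv, hr⟩
    refine ⟨fun n hn => ?_, fun F n ε hε => ?_⟩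
    · obtain ⟨z, hz⟩ := hv n hn
      refine ⟨z - η, ?_⟩
      simpa [add_sub, add_comm η] using hz
    · obtain ⟨ζ, h1, h2, h3⟩ := hr (F.image fun z => η + z) n ε hε
      refine ⟨ζ, h1, h2, fun z hz => ?_⟩
      simpa [add_left_comm η] using h3 _ (Finset.mem_image_of_mem _ hz)

theorem isGδ_genericPart : IsGδ (genericPart Z : Set (LipOne Z)) := by
  refine IsGδ.inter (s := varying Z) (t := recurrent Z) ?_ ?_
  · rw [varying_eq_iInter]
    exact .iInter_of_isOpen fun n => isOpen_varying _
  · rw [recurrent_eq_iInter]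
    exact .iInter_of_isOpen fun p => isOpen_recurrent _ _ _

theorem dense_genericPart (hZ : ¬ FiniteDimensional 𝕜 Z) :
    Dense (genericPart Z : Set (LipOne Z)) := by
  classical
  refine dense_of_mem_residual (inter_mem (s := varying Z) (t := recurrent Z) ?_ ?_)
  · rw [varying_eq_iInter]
    exact countable_iInter_mem.2 fun n =>
      residual_of_dense_open (isOpen_varying _) (dense_varying 𝕜 _)
  · rw [recurrent_eq_iInter]
    exact countable_iInter_mem.2 fun p => residual_of_dense_open (isOpen_recurrent _ _ _)
      (dense_recurrent hZ _ (by positivity) (by positivity))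

/-- If `ζ` were a period, the variation along a vector within `‖ζ‖ / 3` of `ζ` would be below `‖ζ‖ /
3`, yet half the norm of that vector exceeds `‖ζ‖ / 3`. -/
theorem isFreeAction_genericPart : IsFreeAction Z (genericPart Z) := by
  rintro ζ hζ ⟨f, hv, _⟩ hf
  have hper (z : Z) : f.1 (ζ + z) = f.1 z :=
    congrFun (congrArg Subtype.val (congrArg Subtype.val hf)) z
  obtain ⟨n, hn⟩ := (TopologicalSpace.denseRange_denseSeq Z).exists_dist_lt ζ
    (show 0 < ‖ζ‖ / 3 by positivity)
  rw [dist_eq_norm] at hn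
  have h1 := norm_le_norm_add_norm_sub' ζ (TopologicalSpace.denseSeq Z n)
  obtain ⟨z, hz⟩ := hv n fun h => by
    rw [h, sub_zero] at hn
    linarith [norm_pos_iff.2 hζ]
  rw [← hper z] at hz
  have h2 := f.abs_sub_le (TopologicalSpace.denseSeq Z n + z) (ζ + z)
  rw [add_sub_add_right_eq_sub, norm_sub_rev] at h2
  linarith

theorem isStormy_genericPart : IsStormy Z (genericPart Z) := by
  rintro V hV ⟨v, hv⟩ x hopen
  obtain ⟨ρ, hρ, hρV⟩ := Metric.isOpen_iff.1 hV v hv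
  -- Approximate periods at scale `n` have norm below `2 / (n + 1) < ρ`, so they stay in `V`, but
  -- leave the ball of radius `1 / (n + 1)` whose image is tested.
  obtain ⟨n, hn⟩ := exists_nat_one_div_lt (show 0 < ρ / 2 by positivity)
  have hδ : 0 < 1 / (n + 1 : ℝ) := by positivity
  have hS := hopen _ ((Metric.isOpen_ball (x := v) (ε := 1 / (n + 1 : ℝ))).preimage
    (continuous_subtype_val (p := (· ∈ V))))
  obtain ⟨A, hA, hAS⟩ := isOpen_induced_iff.1 hS
  obtain ⟨B, hB, rfl⟩ := isOpen_induced_iff.1 hA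
  have hvB : (v +ᵥ x).1 ∈ B := by
    have : V.imageFactorization (fun g : Z => g +ᵥ x) ⟨v, hv⟩ ∈ _ :=
      mem_image_of_mem _ (show (⟨v, hv⟩ : V) ∈ Subtype.val ⁻¹' Metric.ball v (1 / (n + 1 : ℝ)) from
        Metric.mem_ball_self hδ)
    rw [← hAS] at this
    exact this
  obtain ⟨F, ε, hε, hF⟩ := exists_finset_of_isOpen hB hvB
  obtain ⟨ζ, h1, h2, h3⟩ := (v +ᵥ x).2.2 F n ε hε
  have hζV : ζ + v ∈ V := hρV (by
    rw [Metric.mem_ball, dist_eq_norm, add_sub_cancel_right]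
    linarith)
  have hmem : V.imageFactorization (fun g : Z => g +ᵥ x) ⟨ζ + v, hζV⟩ ∈
      V.imageFactorization (fun g : Z => g +ᵥ x) ''
        (Subtype.val ⁻¹' Metric.ball v (1 / (n + 1 : ℝ))) := by
    rw [← hAS]
    refine hF ((ζ + v) +ᵥ x).1 fun z hz => ?_
    rw [add_vadd]
    exact h3 z hz
  obtain ⟨⟨g, hg⟩, hgb, hgx⟩ := hmem
  replace hgb : dist g v < 1 / (n + 1 : ℝ) := hgb
  have hgx' : g +ᵥ x = (ζ + v) +ᵥ x := congrArg Subtype.val hgx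
  have hgζ : g = ζ + v := by
    by_contra hne
    refine isFreeAction_genericPart (g - (ζ + v)) (sub_ne_zero.2 hne) ((ζ + v) +ᵥ x) ?_
    rw [vadd_vadd, sub_add_cancel, hgx']
  rw [hgζ, dist_eq_norm, add_sub_cancel_right] at hgb
  exact h1.not_gt hgb

end Separable

end LipOne

/-! ### Borel orbit equivalence and conclusion -/

/-- The orbit equivalence relation of a free continuous action of a Polish group on a Polish space
is Borel. -/
theorem IsFreeAction.isBorelEquivalence_orbitRel {G : Type*} {X : Type u} [AddCommGroup G]
    [TopologicalSpace G] [PolishSpace G] [TopologicalSpace X] [PolishSpace X] [MeasurableSpace X]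
    [BorelSpace X] [AddAction G X] [ContinuousVAdd G X] (hfree : IsFreeAction G X) :
    IsBorelEquivalence (AddAction.orbitRel G X) := by
  have hc : Continuous fun q : G × X => (q.1 +ᵥ q.2, q.2) := by fun_prop
  have hinj : Function.Injective fun q : G × X => (q.1 +ᵥ q.2, q.2) := by
    rintro ⟨g, x⟩ ⟨h, y⟩ hgh
    obtain ⟨h1, rfl⟩ := Prod.mk.inj hgh
    refine Prod.ext (by_contra fun hne => hfree (g - h) (sub_ne_zero.2 hne) (h +ᵥ x) ?_) rfl
    rw [vadd_vadd, sub_add_cancel]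
    exact h1
  have hrange : {p : X × X | AddAction.orbitRel G X p.1 p.2} = range fun q : G × X =>
      (q.1 +ᵥ q.2, q.2) := by
    ext ⟨x, y⟩
    simp [AddAction.orbitRel_apply, AddAction.mem_orbit_iff]
  rw [IsBorelEquivalence, hrange]
  exact MeasureTheory.measurableSet_range_of_continuous_injective hc hinj

theorem theorem1p2 {𝕜 : Type w} [RCLike 𝕜] {Z : Type u} [NormedAddCommGroup Z]
    [NormedSpace 𝕜 Z] [CompleteSpace Z] [TopologicalSpace.SeparableSpace Z]
    (hZ : ¬ FiniteDimensional 𝕜 Z) :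
    ∃ X : SubAddAction Z (LipOne Z),
      Dense (X : Set (LipOne Z)) ∧ IsGδ (X : Set (LipOne Z)) ∧
      IsPolishGSpace Z X ∧ IsFreeAction Z X ∧ IsStormy Z X ∧
      IsBorelEquivalence (AddAction.orbitRel Z X) ∧
      ¬ IsEssentiallyCountable.{u, v} (AddAction.orbitRel Z X) := by
  have hd := LipOne.dense_genericPart hZ
  have hP : PolishSpace (LipOne.genericPart Z) := LipOne.isGδ_genericPart.polishSpace
  have hc : ContinuousVAdd Z (LipOne.genericPart Z) := ⟨by
    refine Continuous.subtype_mk (f := fun p : Z × LipOne.genericPart Z => p.1 +ᵥ p.2.1) ?_ _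
    fun_prop⟩
  have hb : BorelSpace (LipOne.genericPart Z) := Subtype.borelSpace _
  have hn : Nonempty (LipOne.genericPart Z) := hd.nonempty.to_subtype
  have hf := LipOne.isFreeAction_genericPart (Z := Z)
  have hs := LipOne.isStormy_genericPart (Z := Z)
  exact ⟨LipOne.genericPart Z, hd, LipOne.isGδ_genericPart, ⟨hP, hc.continuous_vadd⟩, hf, hs,
    hf.isBorelEquivalence_orbitRel, hs.not_isEssentiallyCountable hf⟩
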